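/- Let $d\in\mathbb N$, $d\ge 2$, $s\in(0,1]$, $\gamma\in\mathbb R$ with $-d<\gamma+2s\le 0$, and let $$\frac{d}{d+2s+\gamma}<q<\frac{d}{d+\gamma}$$ (so that, in particular, $-d<\gamma<0$ and $q>1$). Put $\nu=\frac{d-q(d+\gamma)}{2q}$. Then $0<\nu<s$, and there is a constant $C_0>0$ depending only on $d,\gamma,s,q$ such that for every $\varepsilon>0$, every measurable $g:\mathbb R^d\to\mathbb R$ with $g\ge 0$ almost everywhere, and every $\phi:\mathbb R^d\to\mathbb R$ with $\langle\cdot\rangle^{\gamma/2}\phi\in L^2(\mathbb R^d)$, one has $$\int_{\mathbb R^d}\phi^2\,c_\gamma[g]\,dv\le \varepsilon\,\big\|\langle\cdot\rangle^{\gamma/2}\phi\big\|_{\dot H^s}^2+C_0\Big(\|g\|_{L^1}+\varepsilon^{-\frac{\nu}{s-\nu}}\big\|\langle\cdot\rangle^{|\gamma|}g\big\|_{L^q}^{\frac{s}{s-\nu}}\Big)\int_{\mathbb R^d}\phi^2\,\langle v\rangle^\gamma\,dv$$ as an inequality in $[0,\infty]$ (with $0\cdot\infty=0$). Here $\langle v\rangle=\sqrt{1+|v|^2}$,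 $c_\gamma[g](v)=\int_{\mathbb R^d}|v-w|^\gamma g(w)\,dw$, the $L^p$ norms are those of Lebesgue measure, and $\|f\|_{\dot H^s}=\big(\int_{\mathbb R^d}|\widehat f(\xi)|^2|\xi|^{2s}\,d\xi\big)^{1/2}\in[0,\infty]$, where $\widehat f(\xi)=\int_{\mathbb R^d}e^{-ix\cdot\xi}f(x)\,dx$, extended to $f\in L^2$ by Plancherel's theorem. -/

import Mathlib

open MeasureTheory
open scoped ENNReal FourierTransform

noncomputable section

/-- The bracket `⟨v⟩ = √(1 + |v|²)`. -/
def bracket {d : ℕ} (v : EuclideanSpace ℝ (Fin d)) : ℝ :=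
  Real.sqrt (1 + ‖v‖ ^ 2)

/-- The potential `c_γ[g](v) = ∫ |v - w|^γ g(w) dw` of a non-negative function `g`,
with values in `[0, ∞]`. -/
def potential {d : ℕ} (γ : ℝ) (g : EuclideanSpace ℝ (Fin d) → ℝ)
    (v : EuclideanSpace ℝ (Fin d)) : ℝ≥0∞ :=
  ∫⁻ w, ENNReal.ofReal (‖v - w‖ ^ γ) * ENNReal.ofReal (g w)

/-- The homogeneous Sobolev norm `(∫ |f^(ξ)|² |ξ|^(2s) dξ)^(1/2) ∈ [0, ∞]` of `f ∈ L²`, where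
`f^(ξ) = ∫ exp(-i x · ξ) f(x) dx`, extended to `L²` by Plancherel's theorem. Mathlib's transform
`𝓕 f (η) = ∫ exp(-2 π i x · η) f(x) dx` is evaluated at `η = ξ / (2π)`. -/
def homSobolevNorm {d : ℕ} (s : ℝ)
    (f : Lp (α := EuclideanSpace ℝ (Fin d)) ℂ 2 volume) : ℝ≥0∞ :=
  (∫⁻ ξ : EuclideanSpace ℝ (Fin d),
    ‖(𝓕 f : Lp (α := EuclideanSpace ℝ (Fin d)) ℂ 2 volume) ((2 * Real.pi)⁻¹ • ξ)‖ₑ ^ 2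
      * ENNReal.ofReal (‖ξ‖ ^ (2 * s))) ^ (1 / 2 : ℝ)

end

open Filter Topology

/-! Set `F = ⟨·⟩^(γ/2) φ` and `G = ⟨·⟩^|γ| g`. Either `⟨v⟩ ≤ 2|v - w|` or `⟨v⟩ ≤ 2⟨w⟩`, so `⟨v⟩^|γ|
|v - w|^γ` is at most a constant times `1 + ⟨w⟩^|γ| |v - w|^γ` (`bracket_rpow_mul_kernel_le`). The
`1` produces the `L¹` term, and what remains is `∫ |F|² (|·|^γ * G)`.

If `F` has frequencies below `ρ`, Bernstein's inequality bounds `|F|²` by `ρ^d ‖F‖₂²` up to a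
constant. Cutting the kernel at radius `1/ρ`, with Young's inequality inside and Hölder's outside,
bounds the integral by `ρ^(2ν) ‖G‖_q ‖F‖₂²` (`exists_lintegral_mul_riesz_le`), since `2ν = d/q - (d
+ γ)`.

A general `F` is split into a low-frequency block below `r` and dyadic annuli. As `ν < s`, weighted
Cauchy-Schwarz sums the blocks to `‖G‖_q (r^(2ν) ‖F‖₂² + r^(-2(s-ν)) ‖F‖²_{Ḣ^s})` up to a constant
(`exists_lintegral_riesz_le`). Choosing `r` so that the Sobolev coefficient is `ε` gives the powers
of `ε` and `‖G‖_q` in the theorem. -/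

/-! ### Integrals of radial powers. -/

theorem lintegral_comp_smul {d : ℕ} (f : EuclideanSpace ℝ (Fin d) → ℝ≥0∞) {r : ℝ} (hr : 0 < r) :
    ∫⁻ z, f z = ENNReal.ofReal (r ^ d) * ∫⁻ z, f (r • z) := by
  have hme : MeasurableEmbedding (fun z : EuclideanSpace ℝ (Fin d) => r • z) :=
    (Homeomorph.smulOfNeZero r hr.ne').measurableEmbedding
  have h := hme.lintegral_map f (μ := volume)
  rw [Measure.map_addHaar_smul _ hr.ne', lintegral_smul_measure] at h
  rw [← h, smul_eq_mul, ← mul_assoc, finrank_euclideanSpace_fin, abs_of_pos (by positivity),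
    ← ENNReal.ofReal_mul (by positivity), mul_inv_cancel₀ (by positivity), ENNReal.ofReal_one,
    one_mul]

/-- Scaling of the integral of `‖z‖ ^ β` over a radial set. -/
theorem lintegral_indicator_norm_rpow {d : ℕ} (T : Set ℝ) (β : ℝ) {r : ℝ} (hr : 0 < r) :
    ∫⁻ z : EuclideanSpace ℝ (Fin d),
        {z | ‖z‖ / r ∈ T}.indicator (fun z => ENNReal.ofReal (‖z‖ ^ β)) z
      = ENNReal.ofReal (r ^ (β + d)) * ∫⁻ z : EuclideanSpace ℝ (Fin d),
        {z | ‖z‖ ∈ T}.indicator (fun z => ENNReal.ofReal (‖z‖ ^ β)) z := by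
  have h : ∀ z : EuclideanSpace ℝ (Fin d),
      {z : EuclideanSpace ℝ (Fin d) | ‖z‖ / r ∈ T}.indicator
        (fun z => ENNReal.ofReal (‖z‖ ^ β)) (r • z)
      = ENNReal.ofReal (r ^ β)
        * {z | ‖z‖ ∈ T}.indicator (fun z => ENNReal.ofReal (‖z‖ ^ β)) z := by
    intro z
    have hn : ‖r • z‖ = r * ‖z‖ := by rw [norm_smul, Real.norm_of_nonneg hr.le]
    by_cases hz : ‖z‖ ∈ T
    · rw [Set.indicator_of_mem, Set.indicator_of_mem (by exact hz), hn,
        Real.mul_rpow hr.le (norm_nonneg _), ENNReal.ofReal_mul (by positivity)]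
      simpa [hn, hr.ne'] using hz
    · rw [Set.indicator_of_notMem, Set.indicator_of_notMem (by exact hz), mul_zero]
      simpa [hn, hr.ne'] using hz
  rw [lintegral_comp_smul _ hr, lintegral_congr h,
    lintegral_const_mul' _ _ ENNReal.ofReal_ne_top, ← mul_assoc,
    ← ENNReal.ofReal_mul (by positivity), ← Real.rpow_natCast, ← Real.rpow_add hr, add_comm]

theorem lintegral_indicator_norm_rpow_lt_top {d : ℕ} (hd : 0 < d) {T : Set ℝ}
    (hT : MeasurableSet T) {β : ℝ}
    (h : IntegrableOn (fun y : ℝ => y ^ (β + d - 1)) (T ∩ Set.Ioi 0)) :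
    ∫⁻ z : EuclideanSpace ℝ (Fin d),
        {z | ‖z‖ ∈ T}.indicator (fun z => ENNReal.ofReal (‖z‖ ^ β)) z < ∞ := by
  have : Nonempty (Fin d) := ⟨⟨0, hd⟩⟩
  have hint : Integrable (fun z : EuclideanSpace ℝ (Fin d) =>
      T.indicator (fun y : ℝ => y ^ β) ‖z‖) := by
    rw [integrable_fun_norm_addHaar volume (f := T.indicator (fun y : ℝ => y ^ β)),
      finrank_euclideanSpace_fin]
    have h1 : IntegrableOn (T.indicator fun y : ℝ => y ^ (β + d - 1)) (Set.Ioi 0) := by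
      rw [IntegrableOn, integrable_indicator_iff hT, IntegrableOn, Measure.restrict_restrict hT]
      exact h
    refine h1.congr_fun (fun y hy => ?_) measurableSet_Ioi
    have hy0 : (0 : ℝ) < y := hy
    by_cases hyT : y ∈ T
    · simp only [Set.indicator_of_mem hyT, smul_eq_mul]
      rw [← Real.rpow_natCast, ← Real.rpow_add hy0, Nat.cast_sub hd]
      congr 1
      push_cast
      ring
    · simp [Set.indicator_of_notMem hyT]
  refine lt_of_le_of_lt (lintegral_mono fun z => ?_) hint.lintegral_lt_top
  by_cases hz : ‖z‖ ∈ T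
  · rw [Set.indicator_of_mem (by exact hz), Set.indicator_of_mem hz]
  · rw [Set.indicator_of_notMem (by exact hz)]
    exact zero_le

/-- The integral of `‖z‖ ^ β` over the ball of radius `r`. -/
theorem exists_lintegral_ball_norm_rpow {d : ℕ} (hd : 0 < d) {β : ℝ} (hβ : 0 < β + d) :
    ∃ c : ℝ≥0∞, c ≠ ∞ ∧ ∀ r : ℝ, 0 < r →
      ∫⁻ z in {z : EuclideanSpace ℝ (Fin d) | ‖z‖ < r}, ENNReal.ofReal (‖z‖ ^ β)
        = ENNReal.ofReal (r ^ (β + d)) * c := by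
  refine ⟨_, (lintegral_indicator_norm_rpow_lt_top hd (T := Set.Iio 1) (β := β)
    measurableSet_Iio ?_).ne, fun r hr => ?_⟩
  · rw [Set.Iio_inter_Ioi, intervalIntegral.integrableOn_Ioo_rpow_iff one_pos]
    linarith
  · rw [← lintegral_indicator_norm_rpow _ _ hr,
      ← lintegral_indicator (measurableSet_lt measurable_norm measurable_const)]
    simp only [Set.mem_Iio, div_lt_one hr]

/-- The integral of `‖z‖ ^ β` over the complement of the ball of radius `r`. -/
theorem exists_lintegral_compl_ball_norm_rpow {d : ℕ} (hd : 0 < d) {β : ℝ} (hβ : β + d < 0) :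
    ∃ c : ℝ≥0∞, c ≠ ∞ ∧ ∀ r : ℝ, 0 < r →
      ∫⁻ z in {z : EuclideanSpace ℝ (Fin d) | r ≤ ‖z‖}, ENNReal.ofReal (‖z‖ ^ β)
        = ENNReal.ofReal (r ^ (β + d)) * c := by
  refine ⟨_, (lintegral_indicator_norm_rpow_lt_top hd (T := Set.Ici 1) (β := β)
    measurableSet_Ici ?_).ne, fun r hr => ?_⟩
  · rw [Set.inter_eq_left.2 (show Set.Ici (1 : ℝ) ⊆ Set.Ioi 0 from fun y hy => (zero_lt_one.trans_le hy : (0 : ℝ) < y)),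
      integrableOn_Ici_iff_integrableOn_Ioi, integrableOn_Ioi_rpow_iff one_pos]
    linarith
  · rw [← lintegral_indicator_norm_rpow _ _ hr,
      ← lintegral_indicator (measurableSet_le measurable_const measurable_norm)]
    simp only [Set.mem_Ici, one_le_div hr]

/-! ### Bernstein's inequality from `L²` to `L^∞`. -/

/-- The inverse Fourier transform on `L²` is given by the Fourier integral on `L¹ ∩ L²`. -/
theorem Lp_fourierInv_ae_eq_of_integrable {d : ℕ}
    (w : Lp (α := EuclideanSpace ℝ (Fin d)) ℂ 2 volume) (hw : Integrable w) :
    ∀ᵐ x, (𝓕⁻ w : Lp (α := EuclideanSpace ℝ (Fin d)) ℂ 2 volume) x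
      = 𝓕⁻ (w : EuclideanSpace ℝ (Fin d) → ℂ) x := by
  have hcont : Continuous (𝓕⁻ (w : EuclideanSpace ℝ (Fin d) → ℂ)) := by
    rw [Real.fourierInv_eq_fourier_comp_neg]
    exact VectorFourier.fourierIntegral_continuous Real.continuous_fourierChar
      continuous_inner hw.comp_neg
  -- Both sides are tested against smooth compactly supported functions: the `L²` transform moves
  -- onto the test function through tempered distributions, the Fourier integral through Fubini.
  refine ae_eq_of_integral_contDiff_smul_eq
    ((Lp.memLp _).locallyIntegrable (by norm_num)) hcont.locallyIntegrable fun g hg hgc => ?_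
  have hg₁ : HasCompactSupport (Complex.ofRealCLM ∘ g) := hgc.comp_left rfl
  have hg₂ : ContDiff ℝ (⊤ : ℕ∞) (Complex.ofRealCLM ∘ g) := by fun_prop
  set G := hg₁.toSchwartzMap hg₂ with hG
  have h1 := DFunLike.congr_fun (Lp.fourierInv_toTemperedDistribution_eq w) G
  simp only [TemperedDistribution.fourierInv_apply, Lp.toTemperedDistribution_apply] at h1
  have hGx : ∀ x, G x = (g x : ℂ) := fun x => rfl
  have h2 : ∫ x, g x • (𝓕⁻ w : Lp (α := EuclideanSpace ℝ (Fin d)) ℂ 2 volume) x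
      = ∫ x, (𝓕⁻ G) x • (w : EuclideanSpace ℝ (Fin d) → ℂ) x := by
    rw [h1]
    rfl
  rw [h2, SchwartzMap.fourierInv_coe]
  have h3 := VectorFourier.integral_fourierIntegral_smul_eq_flip (μ := volume) (ν := volume)
    (L := -innerₗ (EuclideanSpace ℝ (Fin d))) Real.continuous_fourierChar
    (by simpa using (continuous_inner (𝕜 := ℝ) (E := EuclideanSpace ℝ (Fin d))).fun_neg) G.integrable hw
  have hflip : (-innerₗ (EuclideanSpace ℝ (Fin d))).flip = -innerₗ _ := by
    ext x y
    simp [real_inner_comm]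
  rw [hflip] at h3
  exact h3

/-- An `L²` function whose Fourier transform lives on a set of finite measure is bounded. -/
theorem enorm_fourierInv_sq_le {d : ℕ} (w : Lp (α := EuclideanSpace ℝ (Fin d)) ℂ 2 volume)
    {A : Set (EuclideanSpace ℝ (Fin d))} (hA : MeasurableSet A) (hAfin : volume A ≠ ∞)
    (hwA : ∀ᵐ x, x ∉ A → w x = 0) :
    ∀ᵐ x, ‖(𝓕⁻ w : Lp (α := EuclideanSpace ℝ (Fin d)) ℂ 2 volume) x‖ₑ ^ 2
      ≤ volume A * ∫⁻ y, ‖w y‖ₑ ^ 2 := by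
  have hsm := Lp.aestronglyMeasurable w
  have hL1 : (∫⁻ y, ‖w y‖ₑ) ^ 2 ≤ volume A * ∫⁻ y, ‖w y‖ₑ ^ 2 := by
    have h1 : ∫⁻ y, ‖w y‖ₑ = ∫⁻ y, A.indicator 1 y * ‖w y‖ₑ := by
      refine lintegral_congr_ae ?_
      filter_upwards [hwA] with y hy
      by_cases hyA : y ∈ A
      · simp [hyA]
      · simp [hyA, hy hyA]
    have h2 := ENNReal.lintegral_mul_le_Lp_mul_Lq volume Real.HolderConjugate.two_two
      (f := A.indicator 1) (g := fun y => ‖w y‖ₑ)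
      ((measurable_one.indicator hA).aemeasurable) hsm.enorm
    have h3 : ∫⁻ y, (A.indicator 1 y : ℝ≥0∞) ^ (2 : ℝ) = volume A := by
      rw [← lintegral_indicator_one hA]
      refine lintegral_congr fun y => ?_
      by_cases hyA : y ∈ A <;> simp [hyA]
    rw [h1]
    refine (pow_le_pow_left' h2 2).trans (le_of_eq ?_)
    rw [h3, mul_pow, ← ENNReal.rpow_natCast, ← ENNReal.rpow_natCast, ← ENNReal.rpow_mul,
      ← ENNReal.rpow_mul]
    norm_num
  have hfin : ∫⁻ y, ‖w y‖ₑ ^ 2 ≠ ∞ := by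
    have := (Lp.memLp w).2
    rw [eLpNorm_lt_top_iff_lintegral_rpow_enorm_lt_top (by norm_num) (by norm_num)] at this
    simpa using this.ne
  -- The Cauchy-Schwarz bound `hL1` holds in `[0, ∞]`, so it also proves integrability.
  have hint : Integrable w := by
    refine ⟨hsm, ?_⟩
    rw [HasFiniteIntegral, lt_top_iff_ne_top]
    intro h
    rw [h] at hL1
    simp only [ne_eq, OfNat.ofNat_ne_zero, not_false_eq_true, ENNReal.top_pow, top_le_iff] at hL1
    exact ENNReal.mul_ne_top hAfin hfin hL1
  filter_upwards [Lp_fourierInv_ae_eq_of_integrable w hint] with x hx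
  rw [hx]
  refine le_trans (pow_le_pow_left' ?_ 2) hL1
  rw [Real.fourierInv_eq]
  refine (enorm_integral_le_lintegral_enorm _).trans (le_of_eq (lintegral_congr fun y => ?_))
  rw [Circle.smul_def, enorm_smul, ← ofReal_norm, Circle.norm_coe, ENNReal.ofReal_one, one_mul]

/-! ### The Riesz potential against one frequency block. -/

/-- Interpolation between `L¹` and `L^∞`. -/
theorem lintegral_rpow_le_of_ae_le {α : Type*} [MeasurableSpace α] {μ : Measure α} {p q : ℝ}
    (hpq : p.HolderConjugate q) {b : α → ℝ≥0∞} (hb : Measurable b) {D : ℝ≥0∞}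
    (h : ∀ᵐ v ∂μ, b v ≤ D * ∫⁻ v, b v ∂μ) :
    (∫⁻ v, b v ^ p ∂μ) ^ (1 / p) ≤ D ^ (1 / q) * ∫⁻ v, b v ∂μ := by
  set N := ∫⁻ v, b v ∂μ
  have hp1 : 0 ≤ p - 1 := by linarith [hpq.lt]
  have h1 : ∫⁻ v, b v ^ p ∂μ ≤ (D * N) ^ (p - 1) * N := by
    rw [← lintegral_const_mul _ hb]
    refine lintegral_mono_ae ?_
    filter_upwards [h] with v hv
    calc b v ^ p = b v ^ (p - 1) * b v ^ (1 : ℝ) := by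
          rw [← ENNReal.rpow_add_of_nonneg _ _ hp1 zero_le_one, sub_add_cancel]
      _ ≤ _ := by
          rw [ENNReal.rpow_one]
          gcongr
  have he : (p - 1) * (1 / p) = 1 / q := by
    have := hpq.inv_add_inv_eq_one
    have := hpq.ne_zero
    have := hpq.symm.ne_zero
    field_simp at *
    linarith
  have hp0 : 0 ≤ 1 / p := one_div_nonneg.2 hpq.nonneg
  have hq0 : 0 ≤ 1 / q := one_div_nonneg.2 hpq.symm.nonneg
  calc (∫⁻ v, b v ^ p ∂μ) ^ (1 / p) ≤ ((D * N) ^ (p - 1) * N) ^ (1 / p) :=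
        ENNReal.rpow_le_rpow h1 hp0
    _ = D ^ (1 / q) * (N ^ (1 / q) * N ^ (1 / p)) := by
        rw [ENNReal.mul_rpow_of_nonneg _ _ hp0, ← ENNReal.rpow_mul, he,
          ENNReal.mul_rpow_of_nonneg _ _ hq0, mul_assoc]
    _ = _ := by
        rw [← ENNReal.rpow_add_of_nonneg _ _ hq0 hp0]
        have : 1 / q + 1 / p = 1 := by simpa [add_comm] using hpq.inv_add_inv_eq_one
        rw [this, ENNReal.rpow_one]

/-- A form of Young's convolution inequality. -/
theorem lintegral_mul_conv_le {d : ℕ} {p q : ℝ} (hpq : p.HolderConjugate q)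
    {b K G : EuclideanSpace ℝ (Fin d) → ℝ≥0∞} (hb : Measurable b) (hK : Measurable K)
    (hG : Measurable G) :
    ∫⁻ v, b v * ∫⁻ w, K (v - w) * G w
      ≤ (∫⁻ z, K z) * ((∫⁻ v, b v ^ p) ^ (1 / p) * (∫⁻ w, G w ^ q) ^ (1 / q)) := by
  -- Substituting `z = v - w` and swapping integrals leaves, for each fixed `z`, a Hölder pairing of
  -- `b` with a translate of `G`.
  have h1 : ∀ v, b v * ∫⁻ w, K (v - w) * G w = ∫⁻ z, K z * (b v * G (v - z)) := by
    intro v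
    rw [← lintegral_const_mul _ (by fun_prop), ← lintegral_sub_left_eq_self _ v]
    refine lintegral_congr fun z => ?_
    rw [sub_sub_cancel]
    ring
  rw [lintegral_congr h1, lintegral_lintegral_swap (by fun_prop), ← lintegral_mul_const _ hK]
  refine lintegral_mono fun z => ?_
  rw [lintegral_const_mul _ (by fun_prop)]
  gcongr
  refine (ENNReal.lintegral_mul_le_Lp_mul_Lq volume hpq hb.aemeasurable
    (g := fun v => G (v - z)) (by fun_prop)).trans (le_of_eq ?_)
  congr 2
  exact lintegral_sub_right_eq_self (fun v => G v ^ q) z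

theorem conv_le_Lp_mul_Lq {d : ℕ} {p q : ℝ} (hpq : p.HolderConjugate q)
    {K G : EuclideanSpace ℝ (Fin d) → ℝ≥0∞} (hK : Measurable K)
    (hG : Measurable G) (v : EuclideanSpace ℝ (Fin d)) :
    ∫⁻ w, K (v - w) * G w ≤ (∫⁻ z, K z ^ p) ^ (1 / p) * (∫⁻ w, G w ^ q) ^ (1 / q) := by
  refine (ENNReal.lintegral_mul_le_Lp_mul_Lq volume hpq
    (f := fun w => K (v - w)) (by fun_prop) hG.aemeasurable).trans (le_of_eq ?_)
  congr 2
  exact lintegral_sub_left_eq_self (fun z => K z ^ p) v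

/-- The bound for functions obeying a Bernstein inequality at frequency `ρ`. -/
theorem exists_lintegral_mul_riesz_le {d : ℕ} (hd : 0 < d) {γ q ν : ℝ} (hγ : 0 < γ + d)
    (hq : 1 < q) (hqd : q * (d + γ) < d) (hν : ν = ((d : ℝ) - q * (d + γ)) / (2 * q))
    {B : ℝ≥0∞} (hB : B ≠ ∞) :
    ∃ C : ℝ≥0∞, C ≠ ∞ ∧ ∀ (G b : EuclideanSpace ℝ (Fin d) → ℝ≥0∞) (ρ : ℝ),
      Measurable G → Measurable b → 0 < ρ →
      (∀ᵐ v, b v ≤ (B * ENNReal.ofReal (ρ ^ d)) * ∫⁻ v, b v) →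
      ∫⁻ v, b v * ∫⁻ w, ENNReal.ofReal (‖v - w‖ ^ γ) * G w
        ≤ C * ENNReal.ofReal (ρ ^ (2 * ν)) * (∫⁻ w, G w ^ q) ^ (1 / q) * ∫⁻ v, b v := by
  obtain ⟨p, hpq⟩ : ∃ p : ℝ, p.HolderConjugate q :=
    ⟨_, (Real.HolderConjugate.conjExponent hq).symm⟩
  have hp0 := hpq.pos
  have hq0 := hpq.symm.pos
  have hinv : 1 / p = 1 - 1 / q := by
    have := hpq.inv_add_inv_eq_one
    simp only [one_div]
    linarith
  have hexp : (γ * p + d) * (1 / p) = -(2 * ν) := by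
    have h1 : (γ * p + d) * (1 / p) = γ + d * (1 / p) := by field_simp
    rw [h1, hinv, hν]
    field_simp
    ring
  have hν0 : 0 < ν := by rw [hν]; exact div_pos (by linarith) (by linarith)
  -- Positivity of `ν` is exactly what puts the far part of the kernel in `L^p`.
  have hfar : γ * p + d < 0 := by
    have : (γ * p + d) * (1 / p) < 0 := by rw [hexp]; linarith
    exact (neg_iff_pos_of_mul_neg this).2 (by positivity)
  obtain ⟨c₁, hc₁, h₁⟩ := exists_lintegral_ball_norm_rpow hd hγ
  obtain ⟨c₂, hc₂, h₂⟩ := exists_lintegral_compl_ball_norm_rpow hd hfar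
  refine ⟨c₁ * B ^ (1 / q) + c₂ ^ (1 / p), ENNReal.add_ne_top.2
    ⟨ENNReal.mul_ne_top hc₁ (ENNReal.rpow_ne_top_of_nonneg (by positivity) hB),
      ENNReal.rpow_ne_top_of_nonneg (by positivity) hc₂⟩, fun G b ρ hG hb hρ hbd => ?_⟩
  set N := ∫⁻ v, b v
  set A := (∫⁻ w, G w ^ q) ^ (1 / q)
  -- At the cut radius `ρ⁻¹` the near and far parts both scale as `ρ^(2ν)`.
  have hr : 0 < ρ⁻¹ := by positivity
  have hS1 : MeasurableSet {z : EuclideanSpace ℝ (Fin d) | ‖z‖ < ρ⁻¹} :=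
    measurableSet_lt measurable_norm measurable_const
  have hS2 : MeasurableSet {z : EuclideanSpace ℝ (Fin d) | ρ⁻¹ ≤ ‖z‖} :=
    measurableSet_le measurable_const measurable_norm
  have hKm : Measurable fun z : EuclideanSpace ℝ (Fin d) => ENNReal.ofReal (‖z‖ ^ γ) := by
    fun_prop
  set K₁ := {z : EuclideanSpace ℝ (Fin d) | ‖z‖ < ρ⁻¹}.indicator
    fun z => ENNReal.ofReal (‖z‖ ^ γ)
  set K₂ := {z : EuclideanSpace ℝ (Fin d) | ρ⁻¹ ≤ ‖z‖}.indicator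
    fun z => ENNReal.ofReal (‖z‖ ^ γ)
  have hK₁ : Measurable K₁ := hKm.indicator hS1
  have hK₂ : Measurable K₂ := hKm.indicator hS2
  have hK : ∀ z : EuclideanSpace ℝ (Fin d), ENNReal.ofReal (‖z‖ ^ γ) = K₁ z + K₂ z := by
    intro z
    rcases lt_or_ge ‖z‖ ρ⁻¹ with hz | hz
    · simp [K₁, K₂, hz]
    · simp [K₁, K₂, hz]
  have hnear : ∫⁻ v, b v * ∫⁻ w, K₁ (v - w) * G w
      ≤ c₁ * B ^ (1 / q) * ENNReal.ofReal (ρ ^ (2 * ν)) * A * N := by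
    refine (lintegral_mul_conv_le hpq hb hK₁ hG).trans ?_
    rw [lintegral_indicator hS1, h₁ _ hr]
    have hD : (B * ENNReal.ofReal (ρ ^ d)) ^ (1 / q)
        = B ^ (1 / q) * ENNReal.ofReal (ρ ^ (d / q)) := by
      rw [ENNReal.mul_rpow_of_nonneg _ _ (by positivity),
        ENNReal.ofReal_rpow_of_pos (by positivity), ← Real.rpow_natCast,
        ← Real.rpow_mul hρ.le, mul_one_div]
    have hρe : ENNReal.ofReal (ρ⁻¹ ^ (γ + d)) * ENNReal.ofReal (ρ ^ (d / q))
        = ENNReal.ofReal (ρ ^ (2 * ν)) := by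
      rw [← ENNReal.ofReal_mul (by positivity), Real.inv_rpow hρ.le, ← Real.rpow_neg hρ.le,
        ← Real.rpow_add hρ, hν]
      congr 2
      field_simp
      ring
    calc _ ≤ ENNReal.ofReal (ρ⁻¹ ^ (γ + d)) * c₁
            * ((B * ENNReal.ofReal (ρ ^ d)) ^ (1 / q) * N * A) := by
          gcongr
          exact lintegral_rpow_le_of_ae_le hpq hb hbd
      _ = _ := by
          rw [hD, ← hρe]
          ring
  have hfar' : ∫⁻ v, b v * ∫⁻ w, K₂ (v - w) * G w
      ≤ c₂ ^ (1 / p) * ENNReal.ofReal (ρ ^ (2 * ν)) * A * N := by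
    have hI : (∫⁻ z, K₂ z ^ p) ^ (1 / p) = c₂ ^ (1 / p) * ENNReal.ofReal (ρ ^ (2 * ν)) := by
      have : ∀ z, K₂ z ^ p = {z : EuclideanSpace ℝ (Fin d) | ρ⁻¹ ≤ ‖z‖}.indicator
          (fun z => ENNReal.ofReal (‖z‖ ^ (γ * p))) z := by
        intro z
        rcases lt_or_ge ‖z‖ ρ⁻¹ with hz | hz
        · simp [K₂, hz, hp0]
        · simp only [K₂, Set.indicator_of_mem (show z ∈ {z | ρ⁻¹ ≤ ‖z‖} from hz)]
          rw [ENNReal.ofReal_rpow_of_nonneg (by positivity) hp0.le,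
            ← Real.rpow_mul (norm_nonneg _)]
      rw [lintegral_congr this, lintegral_indicator hS2, h₂ _ hr,
        ENNReal.mul_rpow_of_nonneg _ _ (by positivity),
        ENNReal.ofReal_rpow_of_pos (by positivity), ← Real.rpow_mul hr.le, hexp,
        Real.inv_rpow hρ.le, ← Real.rpow_neg hρ.le, neg_neg, mul_comm]
    rw [← lintegral_const_mul _ hb]
    refine lintegral_mono fun v => ?_
    rw [mul_comm, ← hI]
    gcongr
    exact conv_le_Lp_mul_Lq hpq hK₂ hG v
  calc _ = ∫⁻ v, (b v * ∫⁻ w, K₁ (v - w) * G w) + b v * ∫⁻ w, K₂ (v - w) * G w := by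
        refine lintegral_congr fun v => ?_
        rw [← mul_add, ← lintegral_add_left (by fun_prop)]
        simp_rw [hK, add_mul]
    _ = (∫⁻ v, b v * ∫⁻ w, K₁ (v - w) * G w) + ∫⁻ v, b v * ∫⁻ w, K₂ (v - w) * G w :=
        lintegral_add_left (hb.mul (Measurable.lintegral_prod_right (by fun_prop))) _
    _ ≤ _ := add_le_add hnear hfar'
    _ = _ := by ring

/-! ### Dyadic decomposition in frequency. -/

theorem tsum_mul_sq_le (u v : ℕ → ℝ≥0∞) :
    (∑' j, u j * v j) ^ 2 ≤ (∑' j, u j ^ 2) * ∑' j, v j ^ 2 := by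
  have h := ENNReal.lintegral_mul_le_Lp_mul_Lq Measure.count Real.HolderConjugate.two_two
    (f := u) (g := v) (measurable_of_countable _).aemeasurable
    (measurable_of_countable _).aemeasurable
  simp only [lintegral_count, Pi.mul_apply] at h
  refine (pow_le_pow_left' h 2).trans (le_of_eq ?_)
  rw [mul_pow, ← ENNReal.rpow_natCast, ← ENNReal.rpow_natCast, ← ENNReal.rpow_mul,
    ← ENNReal.rpow_mul]
  norm_num

theorem Lp_two_enorm_sq {α : Type*} [MeasurableSpace α] {μ : Measure α} (f : Lp ℂ 2 μ) :
    ‖f‖ₑ ^ 2 = ∫⁻ x, ‖f x‖ₑ ^ 2 ∂μ := by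
  rw [Lp.enorm_def, eLpNorm_eq_lintegral_rpow_enorm_toReal (by norm_num) (by norm_num),
    ← ENNReal.rpow_natCast, ← ENNReal.rpow_mul]
  norm_num

theorem Lp_two_lintegral_fourierInv {d : ℕ}
    (w : Lp (α := EuclideanSpace ℝ (Fin d)) ℂ 2 volume) :
    ∫⁻ x, ‖(𝓕⁻ w : Lp (α := EuclideanSpace ℝ (Fin d)) ℂ 2 volume) x‖ₑ ^ 2
      = ∫⁻ x, ‖w x‖ₑ ^ 2 := by
  rw [← Lp_two_enorm_sq, ← Lp_two_enorm_sq]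
  congr 1
  exact (Lp.fourierTransformₗᵢ (EuclideanSpace ℝ (Fin d)) ℂ).symm.enorm_map w

/-- The restriction of an `L²` function to the ball of radius `R`. -/
noncomputable def ballCut {d : ℕ} (w : Lp (α := EuclideanSpace ℝ (Fin d)) ℂ 2 volume) (R : ℝ) :
    Lp (α := EuclideanSpace ℝ (Fin d)) ℂ 2 volume :=
  ((Lp.memLp w).indicator (measurableSet_ball (x := (0 : EuclideanSpace ℝ (Fin d))) (ε := R))).toLp

theorem ballCut_ae_eq {d : ℕ} (w : Lp (α := EuclideanSpace ℝ (Fin d)) ℂ 2 volume) (R : ℝ) :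
    ballCut w R =ᵐ[volume] (Metric.ball 0 R).indicator w :=
  MemLp.coeFn_toLp _

theorem tendsto_ballCut {d : ℕ} (w : Lp (α := EuclideanSpace ℝ (Fin d)) ℂ 2 volume)
    {R : ℕ → ℝ} (hR : Tendsto R atTop atTop) :
    Tendsto (fun n => ballCut w (R n)) atTop (𝓝 w) := by
  rw [tendsto_iff_edist_tendsto_0]
  have h : ∀ n, edist (ballCut w (R n)) w
      = (∫⁻ x, ((Metric.ball 0 (R n))ᶜ.indicator (fun x => ‖w x‖ₑ ^ 2) x)) ^ (1 / 2 : ℝ) := by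
    intro n
    rw [edist_eq_enorm_sub]
    have h1 : ‖ballCut w (R n) - w‖ₑ = (‖ballCut w (R n) - w‖ₑ ^ 2) ^ (1 / 2 : ℝ) := by
      rw [← ENNReal.rpow_natCast, ← ENNReal.rpow_mul]
      norm_num
    rw [h1, Lp_two_enorm_sq]
    congr 1
    refine lintegral_congr_ae ?_
    filter_upwards [Lp.coeFn_sub (ballCut w (R n)) w, ballCut_ae_eq w (R n)] with x hx hx'
    rw [hx, Pi.sub_apply, hx']
    by_cases hxA : x ∈ Metric.ball (0 : EuclideanSpace ℝ (Fin d)) (R n)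
    · rw [Set.indicator_of_mem hxA, Set.indicator_of_notMem (not_not.2 hxA)]
      simp
    · rw [Set.indicator_of_notMem hxA, Set.indicator_of_mem (by exact hxA)]
      simp
  simp_rw [h]
  have hfin : ∫⁻ x, ‖w x‖ₑ ^ 2 ≠ ∞ := by
    rw [← Lp_two_enorm_sq]
    exact ENNReal.pow_ne_top enorm_ne_top
  have hmeas : Measurable fun x => ‖w x‖ₑ ^ 2 :=
    ((Lp.stronglyMeasurable w).measurable.enorm).pow_const 2
  have hlim := tendsto_lintegral_of_dominated_convergence (μ := volume)
    (F := fun n x => (Metric.ball 0 (R n))ᶜ.indicator (fun x => ‖w x‖ₑ ^ 2) x)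
    (f := fun _ => 0) (fun x => ‖w x‖ₑ ^ 2)
    (fun n => hmeas.indicator measurableSet_ball.compl)
    (fun n => Eventually.of_forall fun x => Set.indicator_le_self _ _ x) hfin
    (Eventually.of_forall fun x => by
      refine tendsto_const_nhds.congr' ?_
      filter_upwards [hR.eventually_gt_atTop ‖x‖] with n hn
      rw [Set.indicator_of_notMem]
      simpa using hn)
  have := (ENNReal.continuous_rpow_const (y := (1 / 2 : ℝ))).tendsto _ |>.comp hlim
  simpa [Function.comp_def] using this

/-- A dyadic decomposition in frequency, starting at frequency `r`. -/
theorem exists_dyadic_decomposition {d : ℕ}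
    (F : Lp (α := EuclideanSpace ℝ (Fin d)) ℂ 2 volume) {r : ℝ} (hr : 0 < r) :
    ∃ f : ℕ → Lp (α := EuclideanSpace ℝ (Fin d)) ℂ 2 volume,
      (∀ᵐ v, ‖F v‖ₑ ≤ ∑' j, ‖f j v‖ₑ) ∧
      (∀ j, ∀ᵐ v, ‖f j v‖ₑ ^ 2 ≤
        volume (Metric.ball (0 : EuclideanSpace ℝ (Fin d)) (r * 2 ^ j)) * ∫⁻ v, ‖f j v‖ₑ ^ 2) ∧
      (∫⁻ v, ‖f 0 v‖ₑ ^ 2 ≤ ∫⁻ v, ‖F v‖ₑ ^ 2) ∧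
      ∀ j, ∫⁻ v, ‖f (j + 1) v‖ₑ ^ 2
        = ∫⁻ ξ in (fun ξ => ‖ξ‖) ⁻¹' Set.Ico (r * 2 ^ j) (r * 2 ^ (j + 1)),
            ‖(𝓕 F : Lp (α := EuclideanSpace ℝ (Fin d)) ℂ 2 volume) ξ‖ₑ ^ 2 := by
  set W : Lp (α := EuclideanSpace ℝ (Fin d)) ℂ 2 volume := 𝓕 F with hW
  set P : ℕ → Lp (α := EuclideanSpace ℝ (Fin d)) ℂ 2 volume :=
    fun n => ballCut W (r * 2 ^ n) with hP
  -- Sharp cutoffs: index `0` is the whole ball of radius `r`, index `j + 1` the annulus from `r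
  -- 2^j` to `r 2^(j+1)`. Thus every `w j` lives in the ball of radius `r 2^j`.
  set w : ℕ → Lp (α := EuclideanSpace ℝ (Fin d)) ℂ 2 volume :=
    fun n => Nat.casesOn n (P 0) fun j => P (j + 1) - P j with hw
  have hmono : ∀ j : ℕ, r * 2 ^ j ≤ r * 2 ^ (j + 1) := fun j => by
    rw [pow_succ]
    nlinarith [pow_pos (zero_lt_two (α := ℝ)) j]
  have hwsucc : ∀ j, w (j + 1) =ᵐ[volume]
      ((fun ξ => ‖ξ‖) ⁻¹' Set.Ico (r * 2 ^ j) (r * 2 ^ (j + 1))).indicator W := by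
    intro j
    filter_upwards [Lp.coeFn_sub (P (j + 1)) (P j), ballCut_ae_eq W (r * 2 ^ j),
      ballCut_ae_eq W (r * 2 ^ (j + 1))] with x h1 h2 h3
    change (P (j + 1) - P j : Lp (α := EuclideanSpace ℝ (Fin d)) ℂ 2 volume) x = _
    rw [h1, Pi.sub_apply, h2, h3]
    simp only [Set.indicator, mem_ball_zero_iff, Set.mem_preimage, Set.mem_Ico]
    have := hmono j
    split_ifs <;> first | (exfalso; grind) | simp
  have hsum : ∀ n, ∑ j ∈ Finset.range (n + 1), w j = P n := by
    intro n
    induction n with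
    | zero => simp [hw]
    | succ n ih =>
      rw [Finset.sum_range_succ, ih]
      simp [hw]
  have hlim : Tendsto (fun n => (𝓕⁻ (P n) : Lp (α := EuclideanSpace ℝ (Fin d)) ℂ 2 volume))
      atTop (𝓝 F) := by
    have h1 : Tendsto P atTop (𝓝 W) :=
      tendsto_ballCut W ((tendsto_pow_atTop_atTop_of_one_lt one_lt_two).const_mul_atTop hr)
    have h2 := ((Lp.fourierTransformₗᵢ (EuclideanSpace ℝ (Fin d)) ℂ).symm.continuous.tendsto
      W).comp h1
    have h3 : (Lp.fourierTransformₗᵢ (EuclideanSpace ℝ (Fin d)) ℂ).symm W = F :=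
      (Lp.fourierTransformₗᵢ (EuclideanSpace ℝ (Fin d)) ℂ).symm_apply_apply F
    rw [h3] at h2
    exact h2
  have hinvsum : ∀ n, (𝓕⁻ (P n) : Lp (α := EuclideanSpace ℝ (Fin d)) ℂ 2 volume)
      = ∑ j ∈ Finset.range (n + 1), 𝓕⁻ (w j) := by
    intro n
    rw [← hsum]
    exact map_sum (Lp.fourierTransformₗᵢ (EuclideanSpace ℝ (Fin d)) ℂ).symm _ _
  refine ⟨fun j => 𝓕⁻ (w j), ?_, fun j => ?_, ?_, fun j => ?_⟩
  -- The partial sums converge to `F` in `L²`, hence almost everywhere along a subsequence, which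
  -- suffices since each partial sum is dominated by the full series of norms.
  · obtain ⟨φ, -, hφ⟩ := (tendstoInMeasure_of_tendsto_Lp hlim).exists_seq_tendsto_ae
    have hall : ∀ᵐ v, ∀ n, (𝓕⁻ (P n) : Lp (α := EuclideanSpace ℝ (Fin d)) ℂ 2 volume) v
        = ∑ j ∈ Finset.range (n + 1),
          (𝓕⁻ (w j) : Lp (α := EuclideanSpace ℝ (Fin d)) ℂ 2 volume) v := by
      refine ae_all_iff.2 fun n => ?_
      rw [hinvsum]
      filter_upwards [Lp.coeFn_finsetSum (Finset.range (n + 1)) fun j =>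
        (𝓕⁻ (w j) : Lp (α := EuclideanSpace ℝ (Fin d)) ℂ 2 volume)] with v hv
      rw [hv, Finset.sum_apply]
    filter_upwards [hφ, hall] with v hv hv'
    refine le_of_tendsto hv.enorm (Eventually.of_forall fun k => ?_)
    rw [hv']
    exact (enorm_sum_le _ _).trans (ENNReal.sum_le_tsum _)
  · rw [Lp_two_lintegral_fourierInv]
    refine enorm_fourierInv_sq_le (w j) measurableSet_ball measure_ball_lt_top.ne ?_
    cases j with
    | zero =>
      filter_upwards [ballCut_ae_eq W (r * 2 ^ 0)] with x hx hxA
      rw [show w 0 = ballCut W (r * 2 ^ 0) from rfl, hx, Set.indicator_of_notMem hxA]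
    | succ j =>
      filter_upwards [hwsucc j] with x hx hxA
      rw [hx, Set.indicator_of_notMem]
      exact fun h => hxA (mem_ball_zero_iff.2 h.2)
  · rw [Lp_two_lintegral_fourierInv]
    have h1 : ∫⁻ v, ‖F v‖ₑ ^ 2 = ∫⁻ v, ‖W v‖ₑ ^ 2 := by
      rw [← Lp_two_enorm_sq, ← Lp_two_enorm_sq]
      congr 1
      exact ((Lp.fourierTransformₗᵢ (EuclideanSpace ℝ (Fin d)) ℂ).enorm_map F).symm
    rw [h1]
    refine lintegral_mono_ae ?_
    filter_upwards [ballCut_ae_eq W (r * 2 ^ 0)] with x hx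
    rw [show w 0 = ballCut W (r * 2 ^ 0) from rfl, hx]
    by_cases hxA : x ∈ Metric.ball (0 : EuclideanSpace ℝ (Fin d)) (r * 2 ^ 0)
    · rw [Set.indicator_of_mem hxA]
    · rw [Set.indicator_of_notMem hxA]
      simp
  · rw [Lp_two_lintegral_fourierInv, ← lintegral_indicator
      (measurable_norm measurableSet_Ico)]
    refine lintegral_congr_ae ?_
    filter_upwards [hwsucc j] with x hx
    rw [hx]
    by_cases hxA : x ∈ (fun ξ : EuclideanSpace ℝ (Fin d) => ‖ξ‖) ⁻¹'
        Set.Ico (r * 2 ^ j) (r * 2 ^ (j + 1))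
    · rw [Set.indicator_of_mem hxA, Set.indicator_of_mem hxA]
    · rw [Set.indicator_of_notMem hxA, Set.indicator_of_notMem hxA]
      simp

/-- Passing between the two Fourier normalizations costs the factors `(2π)^(-d)` and `(2π)^(-2s)`,
both at most `1`. -/
theorem lintegral_fourier_mul_norm_rpow_le {d : ℕ} {s : ℝ} (hs : 0 ≤ s)
    (F : Lp (α := EuclideanSpace ℝ (Fin d)) ℂ 2 volume) :
    ∫⁻ ξ, ‖(𝓕 F : Lp (α := EuclideanSpace ℝ (Fin d)) ℂ 2 volume) ξ‖ₑ ^ 2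
        * ENNReal.ofReal (‖ξ‖ ^ (2 * s)) ≤ homSobolevNorm s F ^ 2 := by
  have hπ : (1 : ℝ) ≤ 2 * Real.pi := by linarith [Real.pi_gt_three]
  have hπ0 : 0 < (2 * Real.pi)⁻¹ := by positivity
  have hπ1 : (2 * Real.pi)⁻¹ ≤ 1 := inv_le_one_of_one_le₀ hπ
  have h : homSobolevNorm s F ^ 2 = ∫⁻ ξ : EuclideanSpace ℝ (Fin d),
      ‖(𝓕 F : Lp (α := EuclideanSpace ℝ (Fin d)) ℂ 2 volume) ((2 * Real.pi)⁻¹ • ξ)‖ₑ ^ 2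
        * ENNReal.ofReal (‖ξ‖ ^ (2 * s)) := by
    rw [homSobolevNorm, ← ENNReal.rpow_natCast, ← ENNReal.rpow_mul]
    norm_num
  rw [h, lintegral_comp_smul _ hπ0]
  refine (mul_le_of_le_one_left zero_le (ENNReal.ofReal_le_one.2
    (pow_le_one₀ hπ0.le hπ1))).trans (lintegral_mono fun ξ => ?_)
  gcongr
  rw [norm_smul, Real.norm_of_nonneg hπ0.le]
  exact mul_le_of_le_one_left (norm_nonneg _) hπ1

/-! ### Summation over frequency blocks. -/

/-- The bound for `∫ |F|² (|·|^γ * G)` with a free frequency parameter `r`. -/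
theorem exists_lintegral_riesz_le {d : ℕ} (hd : 0 < d) {γ q ν s : ℝ} (hγ : 0 < γ + d)
    (hq : 1 < q) (hqd : q * (d + γ) < d) (hν : ν = ((d : ℝ) - q * (d + γ)) / (2 * q))
    (hνs : ν < s) :
    ∃ C : ℝ≥0∞, C ≠ ∞ ∧ ∀ (F : Lp (α := EuclideanSpace ℝ (Fin d)) ℂ 2 volume)
      (G : EuclideanSpace ℝ (Fin d) → ℝ≥0∞) (r : ℝ), Measurable G → 0 < r →
      ∫⁻ v, ‖F v‖ₑ ^ 2 * ∫⁻ w, ENNReal.ofReal (‖v - w‖ ^ γ) * G w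
        ≤ C * (∫⁻ w, G w ^ q) ^ (1 / q)
          * (ENNReal.ofReal (r ^ (2 * ν)) * (∫⁻ v, ‖F v‖ₑ ^ 2)
            + ENNReal.ofReal (r ^ (-(2 * (s - ν)))) * homSobolevNorm s F ^ 2) := by
  have hν0 : 0 < ν := by rw [hν]; exact div_pos (by linarith) (by linarith)
  have hs0 : 0 < s := hν0.trans hνs
  obtain ⟨C, hC, hmain⟩ := exists_lintegral_mul_riesz_le hd hγ hq hqd hν
    (B := volume (Metric.ball (0 : EuclideanSpace ℝ (Fin d)) 1)) measure_ball_lt_top.ne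
  have h4s : 1 ≤ (2 : ℝ) ^ (2 * s) := Real.one_le_rpow one_le_two (by linarith)
  -- Reciprocal Cauchy-Schwarz weights: `u` is square summable because `ν < s`, and `t j ^ 2` raises
  -- the block growth from `2^(2νj)` to `2^(2sj)`, which the Sobolev norm controls.
  set u : ℕ → ℝ≥0∞ := fun j => ENNReal.ofReal (((2 : ℝ) ^ j) ^ (-(s - ν))) with hu
  set t : ℕ → ℝ≥0∞ := fun j => ENNReal.ofReal (((2 : ℝ) ^ j) ^ (s - ν)) with ht
  have hut : ∀ j, u j * t j = 1 := fun j => by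
    rw [hu, ht, ← ENNReal.ofReal_mul (by positivity), ← Real.rpow_add (by positivity)]
    simp
  have hS : ∑' j, u j ^ 2 ≠ ∞ := by
    have : ∀ j, u j ^ 2 = ENNReal.ofReal ((2 : ℝ) ^ (-(2 * (s - ν)))) ^ j := fun j => by
      rw [hu, ← ENNReal.ofReal_pow (by positivity), ← ENNReal.ofReal_pow (by positivity),
        ← Real.rpow_natCast, ← Real.rpow_natCast, ← Real.rpow_natCast,
        ← Real.rpow_mul (by positivity), ← Real.rpow_mul (by positivity),
        ← Real.rpow_mul (by positivity)]
      congr 2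
      push_cast
      ring
    rw [tsum_congr this, ENNReal.tsum_geometric, ENNReal.inv_ne_top]
    refine (tsub_pos_of_lt ?_).ne'
    rw [ENNReal.ofReal_lt_one]
    exact Real.rpow_lt_one_of_one_lt_of_neg one_lt_two (by linarith)
  refine ⟨(∑' j, u j ^ 2) * C * ENNReal.ofReal ((2 : ℝ) ^ (2 * s)),
    ENNReal.mul_ne_top (ENNReal.mul_ne_top hS hC) ENNReal.ofReal_ne_top,
    fun F G r hG hr => ?_⟩
  obtain ⟨f, hFf, hbern, hf0, hfs⟩ := exists_dyadic_decomposition F hr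
  set H : EuclideanSpace ℝ (Fin d) → ℝ≥0∞ :=
    fun v => ∫⁻ w, ENNReal.ofReal (‖v - w‖ ^ γ) * G w with hH
  have hHm : Measurable H := Measurable.lintegral_prod_right (by fun_prop)
  set A := (∫⁻ w, G w ^ q) ^ (1 / q)
  have hfm : ∀ j, Measurable fun v => ‖f j v‖ₑ ^ 2 := fun j =>
    ((Lp.stronglyMeasurable (f j)).measurable.enorm).pow_const 2
  have hblock : ∀ j, ∫⁻ v, ‖f j v‖ₑ ^ 2 * H v
      ≤ C * ENNReal.ofReal ((r * 2 ^ j) ^ (2 * ν)) * A * ∫⁻ v, ‖f j v‖ₑ ^ 2 := by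
    intro j
    refine hmain G _ (r * 2 ^ j) hG (hfm j) (by positivity) ?_
    have hvol : volume (Metric.ball (0 : EuclideanSpace ℝ (Fin d)) (r * 2 ^ j))
        = volume (Metric.ball (0 : EuclideanSpace ℝ (Fin d)) 1)
          * ENNReal.ofReal ((r * 2 ^ j) ^ d) := by
      rw [Measure.addHaar_ball_of_pos _ _ (by positivity), finrank_euclideanSpace_fin, mul_comm]
    rw [← hvol]
    exact hbern j
  have hsplit : ∫⁻ v, ‖F v‖ₑ ^ 2 * H v
      ≤ (∑' j, u j ^ 2) * ∑' j, t j ^ 2 * ∫⁻ v, ‖f j v‖ₑ ^ 2 * H v := by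
    calc _ ≤ ∫⁻ v, (∑' j, u j ^ 2) * ∑' j, t j ^ 2 * (‖f j v‖ₑ ^ 2 * H v) := by
          refine lintegral_mono_ae ?_
          filter_upwards [hFf] with v hv
          have h1 : ‖F v‖ₑ ≤ ∑' j, u j * (t j * ‖f j v‖ₑ) := by
            refine hv.trans (le_of_eq (tsum_congr fun j => ?_))
            rw [← mul_assoc, hut, one_mul]
          calc ‖F v‖ₑ ^ 2 * H v
              ≤ ((∑' j, u j ^ 2) * ∑' j, (t j * ‖f j v‖ₑ) ^ 2) * H v := by
                gcongr
                exact (pow_le_pow_left' h1 2).trans (tsum_mul_sq_le _ _)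
            _ = _ := by
                rw [mul_assoc, ← ENNReal.tsum_mul_right (f := fun j => (t j * ‖f j v‖ₑ) ^ 2)]
                simp only [mul_pow, mul_assoc]
      _ = _ := by
          rw [lintegral_const_mul' _ _ hS, lintegral_tsum
            (f := fun j v => t j ^ 2 * (‖f j v‖ₑ ^ 2 * H v))
            fun j => (((hfm j).mul hHm).const_mul _).aemeasurable]
          congr 1
          refine tsum_congr fun j => ?_
          exact lintegral_const_mul _ ((hfm j).mul hHm)
  set W : Lp (α := EuclideanSpace ℝ (Fin d)) ℂ 2 volume := 𝓕 F with hW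
  -- The factor `2^(2s)` compares the outer radius `r 2^(j+1)` of the annulus with its inner radius,
  -- the lower bound for `‖ξ‖`.
  have hterm : ∀ j, ENNReal.ofReal (((2 : ℝ) ^ (j + 1)) ^ (s - ν)) ^ 2
        * (ENNReal.ofReal ((r * 2 ^ (j + 1)) ^ (2 * ν)) * ∫⁻ v, ‖f (j + 1) v‖ₑ ^ 2)
      ≤ ENNReal.ofReal ((2 : ℝ) ^ (2 * s)) * ENNReal.ofReal (r ^ (-(2 * (s - ν))))
        * ∫⁻ ξ in (fun ξ => ‖ξ‖) ⁻¹' Set.Ico (r * 2 ^ j) (r * 2 ^ (j + 1)),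
            ‖W ξ‖ₑ ^ 2 * ENNReal.ofReal (‖ξ‖ ^ (2 * s)) := by
    intro j
    rw [hfs j, ← mul_assoc, ← lintegral_const_mul' _ _ (by finiteness),
      ← lintegral_const_mul' _ _ (by finiteness)]
    refine setLIntegral_mono' (measurable_norm measurableSet_Ico) fun ξ hξ => ?_
    rw [mul_comm (‖W ξ‖ₑ ^ 2), ← mul_assoc]
    refine mul_le_mul_left ?_ _
    rw [← ENNReal.ofReal_pow (by positivity), ← ENNReal.ofReal_mul (by positivity),
      ← ENNReal.ofReal_mul (by positivity), ← ENNReal.ofReal_mul (by positivity)]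
    refine ENNReal.ofReal_le_ofReal ?_
    have h2j : (0 : ℝ) < 2 ^ j := by positivity
    have e1 : (((2 : ℝ) ^ (j + 1)) ^ (s - ν)) ^ 2 * (r * 2 ^ (j + 1)) ^ (2 * ν)
        = 2 ^ (2 * s) * r ^ (-(2 * (s - ν))) * (r * 2 ^ j) ^ (2 * s) := by
      rw [pow_succ (2 : ℝ) j, ← Real.rpow_natCast _ 2, ← Real.rpow_mul (by positivity),
        Real.mul_rpow hr.le (by positivity), Real.mul_rpow hr.le (by positivity),
        Real.mul_rpow h2j.le zero_le_two, Real.mul_rpow h2j.le zero_le_two]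
      have a1 : ∀ x : ℝ, 0 < x → x ^ ((s - ν) * (2 : ℕ)) * x ^ (2 * ν) = x ^ (2 * s) := by
        intro x hx
        rw [← Real.rpow_add hx]
        congr 1
        push_cast
        ring
      have a2 : r ^ (2 * ν) = r ^ (-(2 * (s - ν))) * r ^ (2 * s) := by
        rw [← Real.rpow_add hr]
        congr 1
        ring
      rw [← a1 _ h2j, a2, ← a1 _ zero_lt_two]
      ring
    rw [e1]
    gcongr
    exact hξ.1
  have htail : ∑' j, ∫⁻ ξ in (fun ξ => ‖ξ‖) ⁻¹' Set.Ico (r * 2 ^ j) (r * 2 ^ (j + 1)),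
      ‖W ξ‖ₑ ^ 2 * ENNReal.ofReal (‖ξ‖ ^ (2 * s)) ≤ homSobolevNorm s F ^ 2 := by
    have hmono : Monotone fun j : ℕ => r * 2 ^ j := fun i j hij => by
      have := pow_le_pow_right₀ (one_le_two (α := ℝ)) hij
      exact mul_le_mul_of_nonneg_left this hr.le
    rw [← lintegral_iUnion (fun j => measurable_norm measurableSet_Ico)]
    · exact (setLIntegral_le_lintegral _ _).trans (lintegral_fourier_mul_norm_rpow_le hs0.le F)
    · intro i j hij
      exact (hmono.pairwise_disjoint_on_Ico_succ hij).preimage _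
  calc _ ≤ (∑' j, u j ^ 2) * ∑' j, t j ^ 2
          * (C * ENNReal.ofReal ((r * 2 ^ j) ^ (2 * ν)) * A * ∫⁻ v, ‖f j v‖ₑ ^ 2) := by
        refine hsplit.trans ?_
        gcongr with j
        exact hblock j
    _ = (∑' j, u j ^ 2) * C * A * ∑' j, t j ^ 2
          * (ENNReal.ofReal ((r * 2 ^ j) ^ (2 * ν)) * ∫⁻ v, ‖f j v‖ₑ ^ 2) := by
        have : ∀ j, t j ^ 2
            * (C * ENNReal.ofReal ((r * 2 ^ j) ^ (2 * ν)) * A * ∫⁻ v, ‖f j v‖ₑ ^ 2)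
            = C * A * (t j ^ 2
              * (ENNReal.ofReal ((r * 2 ^ j) ^ (2 * ν)) * ∫⁻ v, ‖f j v‖ₑ ^ 2)) := fun j => by ring
        rw [tsum_congr this, ENNReal.tsum_mul_left, ← mul_assoc, ← mul_assoc]
    _ ≤ (∑' j, u j ^ 2) * C * A * (ENNReal.ofReal ((2 : ℝ) ^ (2 * s))
          * (ENNReal.ofReal (r ^ (2 * ν)) * (∫⁻ v, ‖F v‖ₑ ^ 2)
            + ENNReal.ofReal (r ^ (-(2 * (s - ν)))) * homSobolevNorm s F ^ 2)) := by
        gcongr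
        rw [tsum_eq_zero_add' ENNReal.summable, mul_add]
        refine add_le_add ?_ ?_
        · simp only [ht, pow_zero, Real.one_rpow, ENNReal.ofReal_one, one_pow, one_mul, mul_one]
          refine le_trans ?_ (le_mul_of_one_le_left zero_le (ENNReal.one_le_ofReal.2 h4s))
          gcongr
        · refine (ENNReal.tsum_le_tsum hterm).trans ?_
          rw [ENNReal.tsum_mul_left, ← mul_assoc]
          gcongr
    _ = _ := by ring

/-! ### Transfer of the weight. -/

theorem one_le_bracket {d : ℕ} (v : EuclideanSpace ℝ (Fin d)) : 1 ≤ bracket v :=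
  Real.one_le_sqrt.2 (by nlinarith [sq_nonneg ‖v‖])

theorem bracket_pos {d : ℕ} (v : EuclideanSpace ℝ (Fin d)) : 0 < bracket v :=
  one_pos.trans_le (one_le_bracket v)

theorem measurable_bracket {d : ℕ} :
    Measurable (bracket : EuclideanSpace ℝ (Fin d) → ℝ) := by
  unfold bracket
  fun_prop

theorem bracket_le_bracket_add_norm_sub {d : ℕ} (v w : EuclideanSpace ℝ (Fin d)) :
    bracket v ≤ bracket w + ‖v - w‖ := by
  have hw := bracket_pos w
  have hsq : bracket w ^ 2 = 1 + ‖w‖ ^ 2 := Real.sq_sqrt (by positivity)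
  have h1 : ‖v‖ ≤ ‖w‖ + ‖v - w‖ := by
    have := norm_add_le w (v - w)
    rwa [add_sub_cancel] at this
  have h2 : ‖w‖ ≤ bracket w := Real.le_sqrt_of_sq_le (by linarith)
  refine Real.sqrt_le_iff.2 ⟨by positivity, ?_⟩
  nlinarith [norm_nonneg v, norm_nonneg (v - w), mul_le_mul_of_nonneg_right h2
    (norm_nonneg (v - w)), mul_self_le_mul_self (norm_nonneg v) h1]

/-- The weight is absorbed by the kernel away from the diagonal and passes to the other variable
near it. -/
theorem bracket_rpow_mul_kernel_le {d : ℕ} {γ : ℝ} (hγ : γ ≤ 0)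
    (v w : EuclideanSpace ℝ (Fin d)) :
    bracket v ^ (-γ) * ‖v - w‖ ^ γ
      ≤ 2 ^ (-γ) * (1 + bracket w ^ (-γ) * ‖v - w‖ ^ γ) := by
  have hv := bracket_pos v
  have hw := bracket_pos w
  have hlip := bracket_le_bracket_add_norm_sub v w
  have hk : 0 ≤ ‖v - w‖ ^ γ := by positivity
  have h2 : (0 : ℝ) < 2 ^ (-γ) := by positivity
  -- The Lipschitz bound gives `⟨v⟩ ≤ 2|v - w|` in the first case and `⟨v⟩ ≤ 2⟨w⟩` in the second.
  -- The diagonal falls in the second, which needs only that the kernel is nonnegative, whatever its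
  -- value at `0`.
  rcases le_total (bracket w) ‖v - w‖ with h | h
  · have hn : 0 < ‖v - w‖ := hw.trans_le h
    have h1 : bracket v ^ (-γ) * ‖v - w‖ ^ γ ≤ 2 ^ (-γ) := by
      calc _ ≤ (2 * ‖v - w‖) ^ (-γ) * ‖v - w‖ ^ γ := by
            gcongr ?_ * _
            exact Real.rpow_le_rpow hv.le (by linarith) (by linarith)
        _ = 2 ^ (-γ) := by
            rw [Real.mul_rpow zero_le_two hn.le, mul_assoc, ← Real.rpow_add hn]
            simp
    have h3 : 0 ≤ bracket w ^ (-γ) * ‖v - w‖ ^ γ := by positivity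
    nlinarith
  · have h1 : bracket v ^ (-γ) ≤ 2 ^ (-γ) * bracket w ^ (-γ) := by
      rw [← Real.mul_rpow zero_le_two hw.le]
      exact Real.rpow_le_rpow hv.le (by linarith) (by linarith)
    nlinarith [mul_le_mul_of_nonneg_right h1 hk]

theorem bracket_rpow_mul_potential_le {d : ℕ} {γ : ℝ} (hγ : γ ≤ 0)
    {g : EuclideanSpace ℝ (Fin d) → ℝ} (hg : Measurable g) (v : EuclideanSpace ℝ (Fin d)) :
    ENNReal.ofReal (bracket v ^ (-γ)) * potential γ g v
      ≤ ENNReal.ofReal (2 ^ (-γ)) * ((∫⁻ w, ENNReal.ofReal (g w))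
        + ∫⁻ w, ENNReal.ofReal (‖v - w‖ ^ γ) * ENNReal.ofReal (bracket w ^ (-γ) * g w)) := by
  have hb := measurable_bracket (d := d)
  have hpos : ∀ w : EuclideanSpace ℝ (Fin d), 0 ≤ bracket w ^ (-γ) := fun w =>
    Real.rpow_nonneg (bracket_pos w).le _
  rw [potential, ← lintegral_add_left (by fun_prop), ← lintegral_const_mul _ (by fun_prop),
    ← lintegral_const_mul _ (by fun_prop)]
  refine lintegral_mono fun w => ?_
  have h := ENNReal.ofReal_le_ofReal (bracket_rpow_mul_kernel_le hγ v w)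
  rw [ENNReal.ofReal_mul (hpos v), ENNReal.ofReal_mul (by positivity),
    ENNReal.ofReal_add zero_le_one (mul_nonneg (hpos w) (by positivity)),
    ENNReal.ofReal_mul (hpos w), ENNReal.ofReal_one] at h
  calc _ = (ENNReal.ofReal (bracket v ^ (-γ)) * ENNReal.ofReal (‖v - w‖ ^ γ))
          * ENNReal.ofReal (g w) := by ring
    _ ≤ _ := mul_le_mul_left h _
    _ = _ := by
        rw [ENNReal.ofReal_mul (hpos w)]
        ring

/-! ### Choice of the frequency and conclusion. -/

/-- Optimization in the frequency parameter. -/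
theorem exists_pos_optimal {a ε s ν : ℝ} (ha : 0 < a) (hε : 0 < ε) (hνs : ν < s) :
    ∃ r : ℝ, 0 < r ∧ a * r ^ (-(2 * (s - ν))) = ε ∧
      a * r ^ (2 * ν) = ε ^ (-(ν / (s - ν))) * a ^ (s / (s - ν)) := by
  have hs : 0 < s - ν := sub_pos.2 hνs
  have hq : 0 < a / ε := div_pos ha hε
  refine ⟨(a / ε) ^ (1 / (2 * (s - ν))), by positivity, ?_, ?_⟩
  · rw [← Real.rpow_mul hq.le]
    have : 1 / (2 * (s - ν)) * -(2 * (s - ν)) = -1 := by field_simp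
    rw [this, Real.rpow_neg_one]
    field_simp
  · rw [← Real.rpow_mul hq.le]
    have h1 : 1 / (2 * (s - ν)) * (2 * ν) = ν / (s - ν) := by field_simp
    have h2 : s / (s - ν) = 1 + ν / (s - ν) := by
      field_simp
      ring
    rw [h1, h2, Real.rpow_add ha, Real.rpow_one, Real.div_rpow ha.le hε.le, Real.rpow_neg hε.le]
    ring

theorem mainTheorem4 (d : ℕ) (hd : 2 ≤ d) (s γ q ν : ℝ)
    (hs0 : 0 < s) (hs1 : s ≤ 1)
    (hγ0 : -(d : ℝ) < γ + 2 * s) (hγ1 : γ + 2 * s ≤ 0)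
    (hq0 : (d : ℝ) / (d + 2 * s + γ) < q) (hq1 : q < (d : ℝ) / (d + γ))
    (hν : ν = ((d : ℝ) - q * (d + γ)) / (2 * q)) :
    (0 < ν ∧ ν < s) ∧
    ∃ C₀ : ℝ, 0 < C₀ ∧
      ∀ (ε : ℝ), 0 < ε →
      ∀ (g : EuclideanSpace ℝ (Fin d) → ℝ), AEMeasurable g volume → (∀ᵐ v, 0 ≤ g v) →
      ∀ (φ : EuclideanSpace ℝ (Fin d) → ℝ)
        (hφ : MemLp (fun v => ((bracket v ^ (γ / 2) * φ v : ℝ) : ℂ)) 2 volume),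
        ∫⁻ v, ENNReal.ofReal (φ v ^ 2) * potential γ g v
          ≤ ENNReal.ofReal ε * homSobolevNorm s (hφ.toLp _) ^ 2
            + ENNReal.ofReal C₀
              * (eLpNorm g 1 volume
                  + ENNReal.ofReal (ε ^ (-(ν / (s - ν))))
                    * eLpNorm (fun v => bracket v ^ |γ| * g v) (ENNReal.ofReal q) volume
                        ^ (s / (s - ν)))
              * ∫⁻ v, ENNReal.ofReal (φ v ^ 2 * bracket v ^ γ) := by
  have hd0 : (0 : ℝ) < d := by exact_mod_cast (by omega : 0 < d)
  have hden : 0 < (d : ℝ) + 2 * s + γ := by linarith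
  have hq : 1 < q := lt_of_le_of_lt ((one_le_div hden).2 (by linarith)) hq0
  have hγneg : γ < 0 := by linarith
  -- Otherwise `d / (d + γ) ≤ 0`, also when the denominator vanishes, contradicting `1 < q`.
  have hγd : 0 < γ + d := by
    by_contra h
    have := div_nonpos_of_nonneg_of_nonpos hd0.le (by linarith : (d : ℝ) + γ ≤ 0)
    linarith
  have hqd : q * (d + γ) < d := (lt_div_iff₀ (by linarith)).1 hq1
  have hqs : (d : ℝ) < q * (d + 2 * s + γ) := (div_lt_iff₀ hden).1 hq0
  have hν0 : 0 < ν := by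
    rw [hν]
    exact div_pos (by linarith) (by linarith)
  have hνs : ν < s := by
    rw [hν, div_lt_iff₀ (by linarith)]
    linarith
  have hsν : 0 < s - ν := sub_pos.2 hνs
  have hexp : 0 < s / (s - ν) := div_pos hs0 hsν
  refine ⟨⟨hν0, hνs⟩, ?_⟩
  obtain ⟨C, hC, hmain⟩ := exists_lintegral_riesz_le (by omega) hγd hq hqd hν hνs
  set c := ENNReal.ofReal ((2 : ℝ) ^ (-γ)) with hc
  have hcpos : 0 < c := ENNReal.ofReal_pos.2 (by positivity)
  -- The summand `c` serves the `L¹` term; the other is the constant `c * C` raised to the power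
  -- created by the optimization.
  set D := c + (c * C) ^ (s / (s - ν)) with hD
  have hDtop : D ≠ ∞ := ENNReal.add_ne_top.2 ⟨ENNReal.ofReal_ne_top,
    ENNReal.rpow_ne_top_of_nonneg hexp.le (ENNReal.mul_ne_top ENNReal.ofReal_ne_top hC)⟩
  have hDpos : 0 < D := hcpos.trans_le le_self_add
  refine ⟨D.toReal, ENNReal.toReal_pos hDpos.ne' hDtop, fun ε hε g hg _ φ hφ => ?_⟩
  rw [ENNReal.ofReal_toReal hDtop, abs_of_neg hγneg]
  have hb := measurable_bracket (d := d)
  have hbpow : ∀ (v : EuclideanSpace ℝ (Fin d)) (x : ℝ), 0 ≤ bracket v ^ x := fun v x =>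
    Real.rpow_nonneg (bracket_pos v).le _
  set F : Lp (α := EuclideanSpace ℝ (Fin d)) ℂ 2 volume := hφ.toLp _ with hF
  have hFφ : ∀ᵐ v, ‖F v‖ₑ ^ 2 = ENNReal.ofReal (φ v ^ 2 * bracket v ^ γ) := by
    filter_upwards [hφ.coeFn_toLp] with v hv
    rw [hv, ← ofReal_norm, Complex.norm_real, ← ENNReal.ofReal_pow (norm_nonneg _),
      Real.norm_eq_abs, sq_abs, mul_pow, ← Real.rpow_natCast (bracket v ^ (γ / 2)),
      ← Real.rpow_mul (bracket_pos v).le, mul_comm]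
    congr 3
    push_cast
    ring
  have hφF : ∀ᵐ v, ENNReal.ofReal (φ v ^ 2)
      = ‖F v‖ₑ ^ 2 * ENNReal.ofReal (bracket v ^ (-γ)) := by
    filter_upwards [hFφ] with v hv
    rw [hv, ← ENNReal.ofReal_mul (mul_nonneg (sq_nonneg _) (hbpow v _)), mul_assoc,
      ← Real.rpow_add (bracket_pos v)]
    simp
  rw [← lintegral_congr_ae hFφ]
  set N := ∫⁻ v, ‖F v‖ₑ ^ 2 with hN
  have hFm : Measurable fun v => ‖F v‖ₑ ^ 2 :=
    ((Lp.stronglyMeasurable F).measurable.enorm).pow_const 2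
  have hgm := hg.measurable_mk
  have hgae := hg.ae_eq_mk
  set g' := hg.mk g
  have hpot : ∀ v, potential γ g v = potential γ g' v := fun v => by
    refine lintegral_congr_ae ?_
    filter_upwards [hgae] with w hw
    rw [hw]
  set G : EuclideanSpace ℝ (Fin d) → ℝ≥0∞ :=
    fun w => ENNReal.ofReal (bracket w ^ (-γ) * g' w) with hG
  have hGm : Measurable G := by fun_prop
  set A := eLpNorm (fun v => bracket v ^ (-γ) * g v) (ENNReal.ofReal q) volume with hA
  have hGA : (∫⁻ w, G w ^ q) ^ (1 / q) ≤ A := by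
    rw [hA, eLpNorm_eq_lintegral_rpow_enorm_toReal (by simpa using by linarith)
      ENNReal.ofReal_ne_top, ENNReal.toReal_ofReal (by linarith)]
    refine ENNReal.rpow_le_rpow (lintegral_mono_ae ?_) (by positivity)
    filter_upwards [hgae] with w hw
    rw [hw]
    exact ENNReal.rpow_le_rpow (Real.ofReal_le_enorm _) (by linarith)
  have hg1 : ∫⁻ w, ENNReal.ofReal (g' w) ≤ eLpNorm g 1 volume := by
    rw [eLpNorm_one_eq_lintegral_enorm]
    refine lintegral_mono_ae ?_
    filter_upwards [hgae] with w hw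
    rw [← hw]
    exact Real.ofReal_le_enorm _
  set H : EuclideanSpace ℝ (Fin d) → ℝ≥0∞ :=
    fun v => ∫⁻ w, ENNReal.ofReal (‖v - w‖ ^ γ) * G w with hH
  have hHm : Measurable H := Measurable.lintegral_prod_right (by fun_prop)
  have hlhs : ∫⁻ v, ENNReal.ofReal (φ v ^ 2) * potential γ g v
      ≤ c * eLpNorm g 1 volume * N + c * ∫⁻ v, ‖F v‖ₑ ^ 2 * H v := by
    calc _ ≤ ∫⁻ v, c * (∫⁻ w, ENNReal.ofReal (g' w)) * ‖F v‖ₑ ^ 2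
            + c * (‖F v‖ₑ ^ 2 * H v) := by
          refine lintegral_mono_ae ?_
          filter_upwards [hφF] with v hv
          rw [hv, hpot, mul_assoc]
          refine (mul_le_mul_right (bracket_rpow_mul_potential_le hγneg.le hgm v) _).trans
            (le_of_eq ?_)
          ring
      _ = c * (∫⁻ w, ENNReal.ofReal (g' w)) * N + c * ∫⁻ v, ‖F v‖ₑ ^ 2 * H v := by
          rw [lintegral_add_left (hFm.const_mul _), lintegral_const_mul _ hFm]
          congr 1
          exact lintegral_const_mul _ (hFm.mul hHm)
      _ ≤ _ := by gcongr
  -- When `N = 0` the right-hand side may contain `∞ * 0 = 0`, so the left-hand side is shown to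
  -- vanish directly. With `N ≠ 0`, an infinite `A` makes the right-hand side infinite.
  rcases eq_or_ne N 0 with hN0 | hN0
  · have hz : ∫⁻ v, ENNReal.ofReal (φ v ^ 2) * potential γ g v = 0 := by
      rw [← lintegral_zero (μ := (volume : Measure (EuclideanSpace ℝ (Fin d))))]
      refine lintegral_congr_ae ?_
      filter_upwards [hφF, (lintegral_eq_zero_iff hFm).1 hN0] with v hv hv'
      have hv'' : ‖F v‖ₑ ^ 2 = 0 := hv'
      rw [hv, hv'', zero_mul, zero_mul]
    rw [hz]
    exact zero_le
  rcases eq_or_ne A ∞ with hAtop | hAtop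
  · have : ENNReal.ofReal (ε ^ (-(ν / (s - ν)))) * A ^ (s / (s - ν)) = ∞ := by
      rw [hAtop, ENNReal.top_rpow_of_pos hexp]
      exact ENNReal.mul_top (ENNReal.ofReal_pos.2 (by positivity)).ne'
    rw [this, add_top, ENNReal.mul_top hDpos.ne', ENNReal.top_mul hN0, add_top]
    exact le_top
  have hkey : c * ∫⁻ v, ‖F v‖ₑ ^ 2 * H v ≤ ENNReal.ofReal ε * homSobolevNorm s F ^ 2
      + (c * C) ^ (s / (s - ν)) * (ENNReal.ofReal (ε ^ (-(ν / (s - ν))))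
        * A ^ (s / (s - ν))) * N := by
    have hbound : ∀ r : ℝ, 0 < r → c * ∫⁻ v, ‖F v‖ₑ ^ 2 * H v
        ≤ c * C * A * (ENNReal.ofReal (r ^ (2 * ν)) * N
            + ENNReal.ofReal (r ^ (-(2 * (s - ν)))) * homSobolevNorm s F ^ 2) := by
      intro r hr
      rw [mul_assoc c C, mul_assoc c]
      gcongr
      refine (hmain F G r hGm hr).trans ?_
      gcongr
    -- The optimal `r` requires a positive coefficient. For a zero coefficient any `r` works, even
    -- with infinite Sobolev norm, as `0 * ∞ = 0`.
    rcases eq_or_ne (c * C * A) 0 with h0 | h0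
    · refine (hbound 1 one_pos).trans ?_
      rw [h0, zero_mul]
      exact zero_le
    have htop : c * C * A ≠ ∞ :=
      ENNReal.mul_ne_top (ENNReal.mul_ne_top ENNReal.ofReal_ne_top hC) hAtop
    obtain ⟨r, hr, h1, h2⟩ := exists_pos_optimal (ENNReal.toReal_pos h0 htop) hε hνs
    refine (hbound r hr).trans (le_of_eq ?_)
    have ha : c * C * A = ENNReal.ofReal (c * C * A).toReal :=
      (ENNReal.ofReal_toReal htop).symm
    have e1 : c * C * A * ENNReal.ofReal (r ^ (-(2 * (s - ν)))) = ENNReal.ofReal ε := by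
      rw [← h1, ENNReal.ofReal_mul ENNReal.toReal_nonneg, ← ha]
    have e2 : c * C * A * ENNReal.ofReal (r ^ (2 * ν))
        = (c * C) ^ (s / (s - ν)) * (ENNReal.ofReal (ε ^ (-(ν / (s - ν))))
          * A ^ (s / (s - ν))) := by
      calc _ = ENNReal.ofReal ((c * C * A).toReal * r ^ (2 * ν)) := by
            rw [ENNReal.ofReal_mul ENNReal.toReal_nonneg, ← ha]
        _ = ENNReal.ofReal (ε ^ (-(ν / (s - ν)))) * (c * C * A) ^ (s / (s - ν)) := by
            rw [h2, ENNReal.ofReal_mul (by positivity),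
              ← ENNReal.ofReal_rpow_of_nonneg ENNReal.toReal_nonneg hexp.le, ← ha]
        _ = _ := by
            rw [ENNReal.mul_rpow_of_nonneg _ _ hexp.le]
            ring
    rw [mul_add, ← mul_assoc, ← mul_assoc, e1, e2, add_comm]
  refine hlhs.trans ((add_le_add_right hkey _).trans ?_)
  calc _ = ENNReal.ofReal ε * homSobolevNorm s F ^ 2
        + (c * eLpNorm g 1 volume + (c * C) ^ (s / (s - ν))
          * (ENNReal.ofReal (ε ^ (-(ν / (s - ν)))) * A ^ (s / (s - ν)))) * N := by ring
    _ ≤ _ := by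
        rw [mul_add D]
        gcongr
        · exact le_self_add
        · exact le_add_self
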